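/- Let $n\ge 1$ and $0<\lambda_1\le\dots\le\lambda_n$, and let $C=\operatorname{conv}\{\pm\lambda_i e_i : i=1,\dots,n\}\subset\mathbb{R}^n$ be the orthogonal crosspolytope, where $e_i$ is the $i$-th canonical unit vector. Let $V$ denote $n$-dimensional volume, $B_n$ the Euclidean unit ball of $\mathbb{R}^n$, and $\kappa_m$ the volume of the $m$-dimensional unit ball. The quermassintegrals $W_0(C),\dots,W_n(C)$ are the uniquely determined coefficients in the Steiner formula $$V(C+\rho B_n)=\sum_{i=0}^n\binom{n}{i}W_i(C)\,\rho^i\qquad\text{for all }\rho\ge 0 .$$ This formula holds for $C$, and the quermassintegrals are given by $$W_0(C)=\frac{2^n}{n!}\prod_{i=1}^n\lambda_i,\qquad W_1(C)=\frac{2^n}{n!}\sqrt{\sum_{i=1}^n\prod_{j\ne i}\lambda_j^2},$$ and, for every integer $i$ with $0\le i\le n-2$, $$W_{n-i}(C)=\frac{\kappa_{n-i}}{\binom{n}{i}}\,\frac{2^n}{i!\,\pi^{(n-i)/2}}\sum_{\substack{L\subseteq\{1,\dots,n\}\\ |L|=i+1}}\left[\frac{\sum_{k\in L}\prod_{j\in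 L\setminus\{k\}}\lambda_j^2}{\prod_{j=1}^n\lambda_j}\int_0^\infty e^{-\left(\sum_{k\in L}\lambda_k^{-2}\right)x^2}\Bigl(\prod_{j\in\{1,\dots,n\}\setminus L}\int_0^x e^{-y^2/\lambda_j^2}\,dy\Bigr)dx\right].$$ -/

import Mathlib

open MeasureTheory
open scoped Pointwise

noncomputable section

/-- `W 0, …, W n` are coefficients of the relative Steiner polynomial of `K` with respect to `E`:
`V(K + ρ E) = ∑_{i=0}^n (n choose i) W_i ρ^i` for all real `ρ ≥ 0`.
(The values `W i` with `i > n` play no role.) -/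
def IsSteinerCoeff {n : ℕ} (K E : Set (EuclideanSpace ℝ (Fin n))) (W : ℕ → ℝ) : Prop :=
  ∀ ρ : ℝ, 0 ≤ ρ →
    volume.real (K + ρ • E) = ∑ i ∈ Finset.range (n + 1), (n.choose i : ℝ) * W i * ρ ^ i

/-- The coefficients of the Steiner polynomial are uniquely determined. -/
theorem IsSteinerCoeff.unique {n : ℕ} {K E : Set (EuclideanSpace ℝ (Fin n))} {W W' : ℕ → ℝ}
    (h : IsSteinerCoeff K E W) (h' : IsSteinerCoeff K E W') {i : ℕ} (hi : i ≤ n) :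
    W i = W' i := by
  classical
  let p : (ℕ → ℝ) → Polynomial ℝ := fun V =>
    ∑ j ∈ Finset.range (n + 1), Polynomial.monomial j ((n.choose j : ℝ) * V j)
  have hcoeff : ∀ V : ℕ → ℝ, (p V).coeff i = (n.choose i : ℝ) * V i := by
    intro V
    simp only [p, Polynomial.finsetSum_coeff, Polynomial.coeff_monomial]
    rw [Finset.sum_ite_eq' (Finset.range (n + 1)) i (fun j => (n.choose j : ℝ) * V j),
      if_pos (Finset.mem_range.2 (Nat.lt_succ_of_le hi))]
  have heval : ∀ (V : ℕ → ℝ) (ρ : ℝ), (p V).eval ρ =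
      ∑ j ∈ Finset.range (n + 1), (n.choose j : ℝ) * V j * ρ ^ j := by
    intro V ρ
    simp only [p, Polynomial.eval_finsetSum, Polynomial.eval_monomial]
  have hp : p W = p W' := by
    apply Polynomial.eq_of_infinite_eval_eq
    refine (Set.Ici_infinite (0 : ℝ)).mono ?_
    intro ρ hρ
    show (p W).eval ρ = (p W').eval ρ
    rw [heval, heval, ← h ρ hρ, ← h' ρ hρ]
  have hc := congrArg (fun q => Polynomial.coeff q i) hp
  simp only [hcoeff] at hc
  exact mul_left_cancel₀ (Nat.cast_ne_zero.2 (Nat.choose_pos hi).ne') hc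

open Classical in
/-- The relative quermassintegral `W_i(K; E)`, `0 ≤ i ≤ n`: the `i`-th normalised coefficient of
the relative Steiner polynomial (and `0` if there is no such polynomial or `i > n`). -/
def relQuermassintegral {n : ℕ} (K E : Set (EuclideanSpace ℝ (Fin n))) (i : ℕ) : ℝ :=
  if h : i ≤ n ∧ ∃ W : ℕ → ℝ, IsSteinerCoeff K E W then h.2.choose i else 0

/-- The classical quermassintegral `W_i(K) = W_i(K; B_n)`. -/
def quermassintegral {n : ℕ} (K : Set (EuclideanSpace ℝ (Fin n))) (i : ℕ) : ℝ :=
  relQuermassintegral K (Metric.closedBall 0 1) i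

theorem IsSteinerCoeff.relQuermassintegral_eq {n : ℕ} {K E : Set (EuclideanSpace ℝ (Fin n))}
    {W : ℕ → ℝ} (h : IsSteinerCoeff K E W) {i : ℕ} (hi : i ≤ n) :
    relQuermassintegral K E i = W i := by
  have hex : i ≤ n ∧ ∃ W : ℕ → ℝ, IsSteinerCoeff K E W := ⟨hi, W, h⟩
  rw [relQuermassintegral, dif_pos hex]
  exact hex.2.choose_spec.unique h hi

/-- `κ_m`, the volume of the `m`-dimensional Euclidean unit ball. -/
def unitBallVolume (m : ℕ) : ℝ :=
  volume.real (Metric.closedBall (0 : EuclideanSpace ℝ (Fin m)) 1)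

/-- The orthogonal crosspolytope `conv {± λ_i e_i : i = 1, …, n}`. -/
def orthogonalCrosspolytope {n : ℕ} (lam : Fin n → ℝ) : Set (EuclideanSpace ℝ (Fin n)) :=
  convexHull ℝ (⋃ i : Fin n,
    {EuclideanSpace.single i (lam i), -EuclideanSpace.single i (lam i)})

end

/-! In coordinates the crosspolytope `C` is the weighted ℓ¹ ball `∑ |c i| / lam i ≤ 1`, and `C + ρ
B` is its closed `ρ`-neighbourhood. Reflection symmetry reduces the volume to `2 ^ n` times that of
the part in the nonnegative orthant. A point `x` of the orthant outside `C` has its nearest point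
`p` in `C` given by soft thresholding: for a unique level `t > 0`, `p i = x i - t / lam i` where `x
i * lam i > t`, and `p i = 0` elsewhere. Sorting by the support `S` of `p` cuts the orthant part
into a piece of `C` and disjoint regions (`crossNeighborhood_inter_orthant`).

Fix `S` and put `A = ∑ i ∈ S, 1 / lam i ^ 2`. Use as coordinates the barycentric coordinates of `p`
in its face, the level `t`, and `w j = lam j * x j` for `j ∉ S`. This change of variables is affine,
and the conditions decouple (`preimage_faceRegion`): an open simplex of dimension `|S| - 1`, times
the cone `0 ≤ w j ≤ t` cut by the ellipsoid `A t² + ∑ w j ² / lam j ² ≤ ρ²`. The second factor is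
homogeneous in `ρ` of degree `d = n - |S| + 1`. Its constant comes from integrating `exp (-Q)` over
the cone in two ways (`volume_real_cone`): by level sets, which gives `Γ(d/2 + 1)` times the volume,
and by Fubini with `t` outermost, which gives `faceIntegral`.

Each region thus contributes one monomial in `ρ`. Summing proves the Steiner formula with explicit
coefficients, and uniqueness of polynomial coefficients identifies them with the quermassintegrals.
-/

/-! ### Reflection symmetry and the volume of the simplex. -/

theorem map_abs_volume :
    (volume : Measure ℝ).map (fun x => |x|) = (2 : ENNReal) • volume.restrict (Set.Ici 0) := by
  ext s hs
  rw [Measure.map_apply measurable_abs hs, Measure.smul_apply, Measure.restrict_apply hs,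
    smul_eq_mul, two_mul]
  have hsplit : (fun x : ℝ => |x|) ⁻¹' s =
      (s ∩ Set.Ici 0) ∪ (fun x : ℝ => -x) ⁻¹' (s ∩ Set.Ioi 0) := by
    ext x
    simp only [Set.mem_preimage, Set.mem_union, Set.mem_inter_iff, Set.mem_Ici, Set.mem_Ioi]
    rcases le_or_gt 0 x with h | h
    · rw [abs_of_nonneg h]
      constructor
      · exact fun hx => Or.inl ⟨hx, h⟩
      · rintro (hx | hx)
        · exact hx.1
        · linarith [hx.2]
    · rw [abs_of_neg h]
      constructor
      · exact fun hx => Or.inr ⟨hx, by linarith⟩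
      · rintro (hx | hx)
        · linarith [hx.2]
        · exact hx.1
  rw [hsplit, measure_union]
  · congr 1
    rw [Measure.measure_preimage_neg volume (s ∩ Set.Ioi 0), ← Measure.restrict_apply hs,
      ← Measure.restrict_apply hs, Measure.restrict_congr_set Ioi_ae_eq_Ici]
  · rw [Set.disjoint_left]
    rintro x hx hx'
    have h1 : (0 : ℝ) ≤ x := hx.2
    have h2 : (0 : ℝ) < -x := hx'.2
    linarith
  · exact (hs.inter measurableSet_Ioi).preimage measurable_neg

/-- The measure of a set invariant under coordinate reflections is `2 ^ n` times that of its part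
in the nonnegative orthant. -/
theorem volume_preimage_abs {ι : Type*} [Fintype ι] {s : Set (ι → ℝ)} (hs : MeasurableSet s) :
    volume ((fun (x : ι → ℝ) i => |x i|) ⁻¹' s) =
      2 ^ Fintype.card ι * volume (s ∩ Set.univ.pi fun _ => Set.Ici 0) := by
  have hm : Measurable (fun (x : ι → ℝ) i => |x i|) := by fun_prop
  rw [← Measure.map_apply hm hs, volume_pi]
  have : SigmaFinite ((2 : ENNReal) • volume.restrict (Set.Ici (0 : ℝ))) := by
    have h2 : (2 : ENNReal) • volume.restrict (Set.Ici (0 : ℝ)) =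
      (2 : NNReal) • volume.restrict (Set.Ici (0 : ℝ)) := rfl
    rw [h2]
    infer_instance
  have : ∀ i : ι, SigmaFinite ((volume : Measure ℝ).map (fun x => |x|)) := fun _ => by
    rw [map_abs_volume]; infer_instance
  have hmap := Measure.pi_map_pi (Y := fun _ : ι => ℝ) (μ := fun _ : ι => (volume : Measure ℝ))
    (f := fun _ x => |x|) (hμ := this) fun _ => measurable_abs.aemeasurable
  simp_rw [map_abs_volume] at hmap
  rw [hmap]
  rw [Measure.pi_eq (μ' := (2 ^ Fintype.card ι : ENNReal) •
    Measure.pi fun _ : ι => volume.restrict (Set.Ici (0 : ℝ)))]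
  · rw [Measure.smul_apply, smul_eq_mul, ← Measure.restrict_pi_pi, Measure.restrict_apply hs]
  · intro t _
    simp [Measure.pi_pi, Finset.prod_mul_distrib]

theorem volume_pi_pos_ae {ι : Type*} [Fintype ι] (s : Set (ι → ℝ)) :
    volume (s ∩ Set.univ.pi fun _ => Set.Ioi 0) = volume (s ∩ Set.univ.pi fun _ => Set.Ici 0) :=
  measure_congr (ae_eq_set_inter (ae_eq_refl s) (by
    rw [volume_pi]; exact Measure.pi_Ioi_ae_eq_pi_Ici (μ := fun _ : ι => (volume : Measure ℝ)) (f := fun _ => 0)))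

/-- The open ℓ¹ unit ball consists of `2 ^ n` reflected copies of this simplex, up to null sets. -/
theorem volume_open_simplex (ι : Type*) [Fintype ι] :
    volume {z : ι → ℝ | (∀ i, 0 < z i) ∧ ∑ i, z i < 1} =
      ENNReal.ofReal (1 / (Fintype.card ι).factorial) := by
  have hm : MeasurableSet {z : ι → ℝ | ∑ i, z i < 1} :=
    measurableSet_lt (by fun_prop) measurable_const
  have h := volume_preimage_abs hm
  rw [← volume_pi_pos_ae] at h
  have h1 := volume_sum_rpow_lt_one ι (le_refl (1 : ℝ))
  have hl : (fun (x : ι → ℝ) i => |x i|) ⁻¹' {z : ι → ℝ | ∑ i, z i < 1} =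
      {x : ι → ℝ | ∑ i, |x i| ^ (1 : ℝ) < 1} := by
    ext x; simp
  have hr : {z : ι → ℝ | ∑ i, z i < 1} ∩ (Set.univ.pi fun _ => Set.Ioi 0) =
      {z : ι → ℝ | (∀ i, 0 < z i) ∧ ∑ i, z i < 1} := by
    ext x; simp [and_comm]
  rw [hl, hr, h1] at h
  have h2 : Real.Gamma (1 / 1 + 1) = 1 := by norm_num
  rw [h2, mul_one, div_one, Real.Gamma_nat_eq_factorial] at h
  rw [div_eq_mul_one_div, ENNReal.ofReal_mul (by positivity), ENNReal.ofReal_pow (by norm_num)] at h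
  rw [show ENNReal.ofReal 2 = 2 by simp] at h
  exact ((ENNReal.mul_right_inj (by simp) (by simp)).1 h).symm

/-! ### Volume of a cone inside an ellipsoid via Gaussian integrals. -/

section Cone

variable {κ : Type*} [Fintype κ]

theorem volume_cone_scale {K : Set (κ → ℝ)} (hK : ∀ r : ℝ, 0 < r → ∀ v, r • v ∈ K ↔ v ∈ K)
    {Q : (κ → ℝ) → ℝ} (hQ : ∀ (r : ℝ) v, Q (r • v) = r ^ 2 * Q v) {ρ : ℝ} (hρ : 0 < ρ) :
    volume (K ∩ {v | Q v ≤ ρ ^ 2}) =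
      ENNReal.ofReal (ρ ^ Fintype.card κ) * volume (K ∩ {v | Q v ≤ 1}) := by
  rw [← Module.finrank_fintype_fun_eq_card ℝ, ← Measure.addHaar_smul_of_nonneg volume hρ.le]
  congr 1
  ext v
  rw [Set.mem_smul_set_iff_inv_smul_mem₀ hρ.ne']
  simp only [Set.mem_inter_iff, Set.mem_ofPred_eq, hK _ (inv_pos.2 hρ), hQ]
  rw [inv_pow, inv_mul_le_iff₀ (by positivity), mul_one]

theorem lintegral_gamma (d : ℕ) :
    ∫⁻ s in Set.Ioi (0 : ℝ), ENNReal.ofReal (Real.exp (-s)) * ENNReal.ofReal (√s ^ d) =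
      ENNReal.ofReal (Real.Gamma (d / 2 + 1)) := by
  have hd : (0 : ℝ) < d / 2 + 1 := by positivity
  rw [Real.Gamma_eq_integral hd,
    ofReal_integral_eq_lintegral_ofReal (Real.GammaIntegral_convergent hd)]
  · refine setLIntegral_congr_fun measurableSet_Ioi fun s hs => ?_
    have hs : (0 : ℝ) < s := hs
    rw [← ENNReal.ofReal_mul (by positivity), Real.sqrt_eq_rpow, ← Real.rpow_natCast,
      ← Real.rpow_mul hs.le]
    congr 3
    ring
  · refine (ae_restrict_iff' measurableSet_Ioi).2 (Filter.Eventually.of_forall fun s hs => ?_)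
    have hs : (0 : ℝ) < s := hs
    show 0 ≤ _
    positivity

theorem ofReal_exp_neg_eq_lintegral {q : ℝ} (hq : 0 ≤ q) :
    ENNReal.ofReal (Real.exp (-q)) = ∫⁻ s in Set.Ioi (0 : ℝ),
      (Set.Ici q).indicator (fun s => ENNReal.ofReal (Real.exp (-s))) s := by
  rw [setLIntegral_indicator measurableSet_Ici]
  have : (Set.Ici q ∩ Set.Ioi 0 : Set ℝ) =ᵐ[volume] Set.Ioi q := by
    have h1 : (Set.Ici q ∩ Set.Ioi 0 : Set ℝ) =ᵐ[volume] (Set.Ioi q ∩ Set.Ioi 0 : Set ℝ) :=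
      ae_eq_set_inter Ioi_ae_eq_Ici.symm (ae_eq_refl _)
    rwa [Set.Ioi_inter_Ioi, max_eq_left hq] at h1
  rw [setLIntegral_congr this, ← integral_exp_neg_Ioi q,
    ofReal_integral_eq_lintegral_ofReal (integrableOn_exp_neg_Ioi q)]
  exact Filter.Eventually.of_forall fun s => (Real.exp_pos _).le

/-- Write `exp (-Q v)` as the integral of `exp (-s)` over `s ≥ Q v` and swap. The sublevel set at
`s` is the unit one dilated by `√s`, so the remaining integral in `s` is a Gamma integral. -/
theorem lintegral_gaussian_cone {K : Set (κ → ℝ)}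
    (hK : ∀ r : ℝ, 0 < r → ∀ v, r • v ∈ K ↔ v ∈ K)
    {Q : (κ → ℝ) → ℝ} (hQm : Measurable Q) (hQ0 : ∀ v, 0 ≤ Q v)
    (hQ : ∀ (r : ℝ) v, Q (r • v) = r ^ 2 * Q v) :
    ∫⁻ v in K, ENNReal.ofReal (Real.exp (-Q v)) =
      ENNReal.ofReal (Real.Gamma (Fintype.card κ / 2 + 1)) * volume (K ∩ {v | Q v ≤ 1}) := by
  simp_rw [ofReal_exp_neg_eq_lintegral (hQ0 _)]
  rw [lintegral_lintegral_swap]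
  · rw [← lintegral_gamma, ← lintegral_mul_const _ (by fun_prop)]
    refine setLIntegral_congr_fun measurableSet_Ioi fun s hs => ?_
    have hs : (0 : ℝ) < s := hs
    have h1 : ∀ v, (Set.Ici (Q v)).indicator (fun s => ENNReal.ofReal (Real.exp (-s))) s =
        {v | Q v ≤ s}.indicator (fun _ => ENNReal.ofReal (Real.exp (-s))) v := fun v => by
      simp [Set.indicator_apply]
    simp_rw [h1]
    have hms : MeasurableSet {v | Q v ≤ s} := measurableSet_le hQm measurable_const
    rw [lintegral_indicator hms, Measure.restrict_restrict hms, lintegral_const,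
      Measure.restrict_apply_univ, Set.inter_comm, mul_assoc]
    congr 1
    have := volume_cone_scale hK hQ (Real.sqrt_pos.2 hs)
    rwa [Real.sq_sqrt hs.le] at this
  · refine Measurable.aemeasurable ?_
    have hset : MeasurableSet {p : (κ → ℝ) × ℝ | Q p.1 ≤ p.2} :=
      measurableSet_le (hQm.comp measurable_fst) measurable_snd
    have : (Function.uncurry fun (v : κ → ℝ) (s : ℝ) =>
        (Set.Ici (Q v)).indicator (fun s => ENNReal.ofReal (Real.exp (-s))) s) =
        {p : (κ → ℝ) × ℝ | Q p.1 ≤ p.2}.indicator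
          (fun p => ENNReal.ofReal (Real.exp (-p.2))) := by
      ext p; simp [Function.uncurry, Set.indicator_apply]
    rw [this]
    exact Measurable.indicator (by fun_prop) hset

end Cone

theorem lintegral_ofReal_prod {ι : Type*} [Fintype ι] {f : ι → ℝ → ℝ}
    (hf : ∀ i, Integrable (f i)) (h0 : ∀ i x, 0 ≤ f i x) :
    ∫⁻ x : ι → ℝ, ENNReal.ofReal (∏ i, f i (x i)) = ENNReal.ofReal (∏ i, ∫ x, f i x) := by
  rw [← integral_fintype_prod_volume_eq_prod, ofReal_integral_eq_lintegral_ofReal]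
  · exact Integrable.fintype_prod (f := f) hf
  · exact Filter.Eventually.of_forall fun x => Finset.prod_nonneg fun i _ => h0 i _

/-- Fubini's theorem on `κ → ℝ` with one coordinate singled out. -/
theorem lintegral_pi_split {κ : Type*} [Fintype κ] [DecidableEq κ] (k : κ)
    {F : (κ → ℝ) → ENNReal} (hF : Measurable F) :
    ∫⁻ v, F v = ∫⁻ t : ℝ, ∫⁻ u : {j // ¬ j = k} → ℝ,
      F (fun j => if h : j = k then t else u ⟨j, h⟩) := by
  let e := MeasurableEquiv.piEquivPiSubtypeProd (fun _ : κ => ℝ) (· = k)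
  have he : MeasurePreserving e := by
    convert volume_preserving_piEquivPiSubtypeProd (fun _ : κ => ℝ) (· = k)
  have hg : Measurable fun p : ({j // j = k} → ℝ) × ({j // ¬ j = k} → ℝ) => F (e.symm p) :=
    hF.comp e.symm.measurable
  have h1 : ∫⁻ v, F v = ∫⁻ p, F (e.symm p) := by
    rw [← he.lintegral_comp hg]
    simp
  have hu : MeasurePreserving (MeasurableEquiv.funUnique {j // j = k} ℝ) := by
    convert volume_preserving_funUnique {j // j = k} ℝ <;> rfl
  rw [h1, Measure.volume_eq_prod, lintegral_prod _ hg.aemeasurable,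
    ← hu.symm.lintegral_comp hg.lintegral_prod_right']
  rfl

/-- Once `v k = t` is fixed, the other coordinates range independently over `[0, t]` and the
Gaussian factorises. -/
theorem gaussian_cone_lintegral {κ : Type*} [Fintype κ] [DecidableEq κ] (k : κ) (b : κ → ℝ) :
    ∫⁻ v in {v : κ → ℝ | 0 < v k ∧ ∀ j, 0 ≤ v j ∧ v j ≤ v k},
        ENNReal.ofReal (Real.exp (-∑ j, b j * v j ^ 2)) =
      ∫⁻ t in Set.Ioi (0 : ℝ), ENNReal.ofReal (Real.exp (-b k * t ^ 2) *
        ∏ j ∈ Finset.univ.erase k, ∫ u in (0 : ℝ)..t, Real.exp (-b j * u ^ 2)) := by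
  have hK : MeasurableSet {v : κ → ℝ | 0 < v k ∧ ∀ j, 0 ≤ v j ∧ v j ≤ v k} := by
    measurability
  rw [← lintegral_indicator hK, lintegral_pi_split k (Measurable.indicator (by fun_prop) hK),
    ← lintegral_indicator measurableSet_Ioi]
  refine lintegral_congr fun t => ?_
  rcases le_or_gt t 0 with ht | ht
  · rw [Set.indicator_of_notMem (by simpa using ht)]
    refine (lintegral_congr fun u => ?_).trans lintegral_zero
    refine Set.indicator_of_notMem (fun h => ?_) _
    have h1 := h.1
    simp only [dite_true] at h1
    linarith
  · rw [Set.indicator_of_mem (by simpa using ht)]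
    let f : {j // ¬ j = k} → ℝ → ℝ := fun j =>
      (Set.Icc 0 t).indicator fun u => Real.exp (-b j * u ^ 2)
    have hf : ∀ j, Integrable (f j) := fun j =>
      (integrable_indicator_iff measurableSet_Icc).2
        (Continuous.integrableOn_Icc (by fun_prop))
    have hf0 : ∀ j u, 0 ≤ f j u := fun j u => Set.indicator_nonneg (fun _ _ => (Real.exp_pos _).le) u
    have hfi : ∀ j, ∫ u, f j u = ∫ u in (0 : ℝ)..t, Real.exp (-b j * u ^ 2) := fun j => by
      rw [integral_indicator measurableSet_Icc, integral_Icc_eq_integral_Ioc,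
        intervalIntegral.integral_of_le ht.le]
    have hprod : ∏ j ∈ Finset.univ.erase k, ∫ u in (0 : ℝ)..t, Real.exp (-b j * u ^ 2) =
        ∏ j, ∫ u, f j u := by
      simp_rw [hfi]
      exact Finset.prod_subtype _ (by simp) _
    rw [hprod, ENNReal.ofReal_mul (Real.exp_pos _).le, ← lintegral_ofReal_prod hf hf0,
      ← lintegral_const_mul' _ _ ENNReal.ofReal_ne_top]
    refine lintegral_congr fun u => ?_
    rw [← ENNReal.ofReal_mul (Real.exp_pos _).le]
    by_cases hu : ∀ j, 0 ≤ u j ∧ u j ≤ t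
    · rw [Set.indicator_of_mem]
      · have h1 : ∀ j, f j (u j) = Real.exp (-b j * u j ^ 2) := fun j =>
          Set.indicator_of_mem (show u j ∈ Set.Icc 0 t from hu j) _
        simp_rw [h1]
        rw [← Real.exp_sum, ← Real.exp_add, ← Finset.add_sum_erase _ _ (Finset.mem_univ k),
          Finset.sum_subtype (Finset.univ.erase k) (p := fun j => ¬ j = k) (by simp)]
        congr 2
        rw [neg_add, ← Finset.sum_neg_distrib]
        simp only [dite_true, neg_mul]
        congr 1
        refine Finset.sum_congr rfl fun j _ => ?_
        rw [dif_neg j.2]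
      · refine ⟨by simpa using ht, fun j => ?_⟩
        by_cases hj : j = k
        · simp [hj, ht.le]
        · simpa [hj] using hu ⟨j, hj⟩
    · rw [Set.indicator_of_notMem]
      · push Not at hu
        obtain ⟨j, hj⟩ := hu
        rw [Finset.prod_eq_zero (Finset.mem_univ j), mul_zero, ENNReal.ofReal_zero]
        exact Set.indicator_of_notMem (fun h => (hj h.1).not_ge h.2) _
      · rintro ⟨-, h⟩
        refine hu fun j => ?_
        have := h j
        simpa [j.2] using this

/-- Volume of the intersection of a cone with an ellipsoid, through a Gaussian integral. -/
theorem volume_real_cone {κ : Type*} [Fintype κ] [DecidableEq κ] (k : κ) {b : κ → ℝ}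
    (hb : ∀ j, 0 < b j) {ρ : ℝ} (hρ : 0 ≤ ρ) :
    volume.real {v : κ → ℝ | (0 < v k ∧ ∀ j, 0 ≤ v j ∧ v j ≤ v k) ∧ ∑ j, b j * v j ^ 2 ≤ ρ ^ 2} =
      ρ ^ Fintype.card κ * ((∫ t in Set.Ioi (0 : ℝ), Real.exp (-b k * t ^ 2) *
        ∏ j ∈ Finset.univ.erase k, ∫ u in (0 : ℝ)..t, Real.exp (-b j * u ^ 2)) /
        Real.Gamma (Fintype.card κ / 2 + 1)) := by
  rcases hρ.eq_or_lt with rfl | hρ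
  -- At `ρ = 0` scaling is unavailable, but the set is empty because `v k > 0`.
  · have hne : Fintype.card κ ≠ 0 := (Fintype.card_pos_iff.2 ⟨k⟩).ne'
    rw [zero_pow hne, zero_mul]
    convert measureReal_empty
    refine Set.eq_empty_of_forall_notMem fun v hv => ?_
    have h1 := Finset.single_le_sum (f := fun j => b j * v j ^ 2)
      (fun j _ => mul_nonneg (hb j).le (sq_nonneg _)) (Finset.mem_univ k)
    have h2 : 0 < b k * v k ^ 2 := mul_pos (hb k) (pow_pos hv.1.1 2)
    have h3 := hv.2
    norm_num at h3
    linarith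
  · set K : Set (κ → ℝ) := {v | 0 < v k ∧ ∀ j, 0 ≤ v j ∧ v j ≤ v k} with hKdef
    set Q : (κ → ℝ) → ℝ := fun v => ∑ j, b j * v j ^ 2 with hQdef
    have hK : ∀ r : ℝ, 0 < r → ∀ v, r • v ∈ K ↔ v ∈ K := fun r hr v => by
      simp [hKdef, hr]
    have hQ : ∀ (r : ℝ) v, Q (r • v) = r ^ 2 * Q v := fun r v => by
      simp only [hQdef, Pi.smul_apply, smul_eq_mul, Finset.mul_sum]
      exact Finset.sum_congr rfl fun j _ => by ring
    have hG := lintegral_gaussian_cone hK (by fun_prop : Measurable Q)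
      (fun v => Finset.sum_nonneg fun j _ => mul_nonneg (hb j).le (sq_nonneg _)) hQ
    have hS := volume_cone_scale hK hQ hρ
    rw [gaussian_cone_lintegral] at hG
    have hΓ : 0 < Real.Gamma (Fintype.card κ / 2 + 1) := Real.Gamma_pos_of_pos (by positivity)
    have hset : {v : κ → ℝ | (0 < v k ∧ ∀ j, 0 ≤ v j ∧ v j ≤ v k) ∧
        ∑ j, b j * v j ^ 2 ≤ ρ ^ 2} = K ∩ {v | Q v ≤ ρ ^ 2} := rfl
    rw [hset, Measure.real, hS, ENNReal.toReal_mul, ENNReal.toReal_ofReal (by positivity)]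
    congr 1
    rw [eq_div_iff hΓ.ne', integral_eq_lintegral_of_nonneg_ae, hG, ENNReal.toReal_mul,
      ENNReal.toReal_ofReal hΓ.le, mul_comm]
    · refine (ae_restrict_iff' measurableSet_Ioi).2 (Filter.Eventually.of_forall fun t ht => ?_)
      have ht : (0 : ℝ) < t := ht
      refine mul_nonneg (Real.exp_pos _).le (Finset.prod_nonneg fun j _ => ?_)
      exact intervalIntegral.integral_nonneg ht.le fun u _ => (Real.exp_pos _).le
    · refine Continuous.aestronglyMeasurable ?_
      refine Continuous.mul (by fun_prop) (continuous_finsetProd _ fun j _ => ?_)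
      exact intervalIntegral.continuous_primitive
        (fun a b => Continuous.intervalIntegrable (by fun_prop) a b) 0

theorem measurableSet_open_simplex (ι : Type*) [Fintype ι] :
    MeasurableSet {z : ι → ℝ | (∀ i, 0 < z i) ∧ ∑ i, z i < 1} := by
  have h : {z : ι → ℝ | (∀ i, 0 < z i) ∧ ∑ i, z i < 1} =
      (Set.univ.pi fun _ => Set.Ioi 0) ∩ {z | ∑ i, z i < 1} := by
    ext; simp
  rw [h]
  exact (MeasurableSet.univ_pi fun _ => measurableSet_Ioi).inter
    (measurableSet_lt (by fun_prop) measurable_const)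

theorem measurableSet_cone {κ : Type*} [Fintype κ] (k : κ) (b : κ → ℝ) (ρ : ℝ) :
    MeasurableSet {v : κ → ℝ | (0 < v k ∧ ∀ j, 0 ≤ v j ∧ v j ≤ v k) ∧
      ∑ j, b j * v j ^ 2 ≤ ρ ^ 2} := by
  have hK : MeasurableSet {v : κ → ℝ | 0 < v k ∧ ∀ j, 0 ≤ v j ∧ v j ≤ v k} := by
    measurability
  have hQ : MeasurableSet {v : κ → ℝ | ∑ j, b j * v j ^ 2 ≤ ρ ^ 2} :=
    measurableSet_le (by fun_prop) measurable_const
  exact hK.inter hQ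

/-! ### The region over one face and its volume. -/

section Region

variable {ι : Type*} [Fintype ι] [DecidableEq ι]

/-- The points of the nonnegative orthant outside the crosspolytope whose nearest point in the
crosspolytope has support `S` and lies at distance at most `ρ`. -/
def faceRegion (lam : ι → ℝ) (S : Finset ι) (ρ : ℝ) : Set (ι → ℝ) :=
  -- The quotient is the threshold level `t`, fixed by requiring `∑ i ∈ S, (x i - t / lam i) / lam i
  -- = 1`.
  {x | 0 < (∑ i ∈ S, x i / lam i - 1) / (∑ i ∈ S, 1 / lam i ^ 2) ∧
    (∀ i ∈ S, (∑ i ∈ S, x i / lam i - 1) / (∑ i ∈ S, 1 / lam i ^ 2) < x i * lam i) ∧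
    (∀ j ∉ S, 0 ≤ x j ∧ x j * lam j ≤ (∑ i ∈ S, x i / lam i - 1) / (∑ i ∈ S, 1 / lam i ^ 2)) ∧
    (∑ i ∈ S, 1 / lam i ^ 2) * ((∑ i ∈ S, x i / lam i - 1) / (∑ i ∈ S, 1 / lam i ^ 2)) ^ 2 +
      ∑ j ∈ Finset.univ \ S, x j ^ 2 ≤ ρ ^ 2}

theorem measurableSet_faceRegion (lam : ι → ℝ) (S : Finset ι) (ρ : ℝ) :
    MeasurableSet (faceRegion lam S ρ) := by
  unfold faceRegion
  measurability

/-- The linear part of the parametrisation of `faceRegion lam S ρ` by a simplex and a cone. -/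
noncomputable def faceMap (lam : ι → ℝ) (S : Finset ι) (k : ι) : (ι → ℝ) →ₗ[ℝ] (ι → ℝ) :=
  -- The rightmost factor adds the normal displacement `w k / lam i ^ 2` for `i ∈ S.erase k` and
  -- multiplies coordinate `k` by `A`. The middle one subtracts the other `S`-coordinates from
  -- coordinate `k`, which leaves `w k / lam k ^ 2 - ∑ w i` there. The base point of the
  -- parametrisation is the vertex `lam k • e k`.
  Matrix.toLin' (Matrix.diagonal fun i => if i ∈ S then lam i else 1 / lam i) ∘ₗ
    LinearMap.transvection (-∑ i ∈ S.erase k, LinearMap.proj i) (Pi.single k 1) ∘ₗ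
    LinearMap.transvection (LinearMap.proj k) (fun i =>
      if i = k then (∑ i ∈ S, 1 / lam i ^ 2) - 1 else if i ∈ S then 1 / lam i ^ 2 else 0)

/-- A map `x ↦ x + f x • v` has determinant `1 + f v`: this is `A` for the rightmost factor and `1`
for the middle one. -/
theorem det_faceMap (lam : ι → ℝ) (S : Finset ι) (k : ι) :
    LinearMap.det (faceMap lam S k) =
      (∏ i, if i ∈ S then lam i else 1 / lam i) * ∑ i ∈ S, 1 / lam i ^ 2 := by
  have h : (∑ i ∈ S.erase k, (LinearMap.proj i : (ι → ℝ) →ₗ[ℝ] ℝ)) (Pi.single k 1) = 0 := by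
    rw [LinearMap.sum_apply]
    exact Finset.sum_eq_zero fun i hi => by simp [Finset.ne_of_mem_erase hi]
  rw [faceMap, LinearMap.det_comp, LinearMap.det_comp, LinearMap.det_toLin', Matrix.det_diagonal,
    LinearMap.transvection.det, LinearMap.transvection.det, LinearMap.neg_apply, h]
  simp

variable {lam : ι → ℝ} {S : Finset ι} {k : ι}

theorem faceMap_apply_self (hk : k ∈ S) (w : ι → ℝ) :
    faceMap lam S k w k = lam k * (1 / lam k ^ 2 * w k - ∑ i ∈ S.erase k, w i) := by
  have h : ∀ i ∈ S.erase k, (w i + w k * if i = k then (∑ i ∈ S, 1 / lam i ^ 2) - 1 else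
      if i ∈ S then 1 / lam i ^ 2 else 0) = w i + w k * (1 / lam i ^ 2) := fun i hi => by
    rw [if_neg (Finset.ne_of_mem_erase hi), if_pos (Finset.mem_of_mem_erase hi)]
  have hA := Finset.add_sum_erase S (fun i => 1 / lam i ^ 2) hk
  simp only [faceMap, LinearMap.comp_apply, Matrix.toLin'_apply, Matrix.mulVec_diagonal, hk,
    LinearMap.transvection.apply, if_true, Pi.add_apply, Pi.smul_apply, smul_eq_mul,
    LinearMap.neg_apply, LinearMap.sum_apply, LinearMap.proj_apply, Pi.single_eq_same]
  rw [Finset.sum_congr rfl h, Finset.sum_add_distrib, ← Finset.mul_sum, ← hA]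
  ring

theorem faceMap_apply_of_mem (w : ι → ℝ) {i : ι} (hi : i ∈ S) (hik : i ≠ k) :
    faceMap lam S k w i = lam i * (w i + 1 / lam i ^ 2 * w k) := by
  simp [faceMap, LinearMap.transvection.apply, Matrix.mulVec_diagonal, hi, hik, mul_comm]

theorem faceMap_apply_of_notMem (hk : k ∈ S) (w : ι → ℝ) {j : ι} (hj : j ∉ S) :
    faceMap lam S k w j = w j / lam j := by
  have hjk : j ≠ k := fun h => hj (h ▸ hk)
  simp [faceMap, LinearMap.transvection.apply, Matrix.mulVec_diagonal, hj, hjk]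
  field_simp

/-- In the new coordinates the threshold level is exactly `w k`, so the simplex conditions involve
only `S.erase k` and all the others only its complement. -/
theorem preimage_faceRegion (hk : k ∈ S) (hpos : ∀ i, 0 < lam i) (ρ : ℝ) :
    (fun w => Pi.single k (lam k) + faceMap lam S k w) ⁻¹' faceRegion lam S ρ =
      {w | ((∀ i ∈ S.erase k, 0 < w i) ∧ ∑ i ∈ S.erase k, w i < 1) ∧
        (0 < w k ∧ ∀ j ∉ S, 0 ≤ w j ∧ w j ≤ w k) ∧
        (∑ i ∈ S, 1 / lam i ^ 2) * w k ^ 2 + ∑ j ∈ Finset.univ \ S, 1 / lam j ^ 2 * w j ^ 2 ≤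
          ρ ^ 2} := by
  ext w
  have hAS : 0 < ∑ i ∈ S, 1 / lam i ^ 2 :=
    Finset.sum_pos (fun i _ => by have := hpos i; positivity) ⟨k, hk⟩
  set x := Pi.single k (lam k) + faceMap lam S k w with hx
  have hxk : x k = lam k * (1 + 1 / lam k ^ 2 * w k - ∑ i ∈ S.erase k, w i) := by
    rw [hx, Pi.add_apply, faceMap_apply_self hk]
    simp
    ring
  have hxi : ∀ i ∈ S.erase k, x i = lam i * (w i + 1 / lam i ^ 2 * w k) := fun i hi => by
    rw [hx, Pi.add_apply, faceMap_apply_of_mem w (Finset.mem_of_mem_erase hi)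
      (Finset.ne_of_mem_erase hi)]
    simp [Finset.ne_of_mem_erase hi]
  have hxj : ∀ j ∉ S, x j = w j / lam j := fun j hj => by
    rw [hx, Pi.add_apply, faceMap_apply_of_notMem hk w hj]
    simp [show j ≠ k from fun h => hj (h ▸ hk)]
  have ht : (∑ i ∈ S, x i / lam i - 1) / (∑ i ∈ S, 1 / lam i ^ 2) = w k := by
    rw [div_eq_iff hAS.ne', ← Finset.add_sum_erase S _ hk,
      ← Finset.add_sum_erase S (fun i => 1 / lam i ^ 2) hk, hxk, mul_div_cancel_left₀ _ (hpos k).ne']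
    have : ∑ i ∈ S.erase k, x i / lam i = ∑ i ∈ S.erase k, (w i + 1 / lam i ^ 2 * w k) :=
      Finset.sum_congr rfl fun i hi => by rw [hxi i hi, mul_div_cancel_left₀ _ (hpos i).ne']
    rw [this, Finset.sum_add_distrib, ← Finset.sum_mul]
    ring
  have hsq : ∑ j ∈ Finset.univ \ S, x j ^ 2 = ∑ j ∈ Finset.univ \ S, 1 / lam j ^ 2 * w j ^ 2 :=
    Finset.sum_congr rfl fun j hj => by
      rw [hxj j (Finset.mem_sdiff.1 hj).2]
      ring
  have hSmem : (∀ i ∈ S, w k < x i * lam i) ↔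
      (∀ i ∈ S.erase k, 0 < w i) ∧ ∑ i ∈ S.erase k, w i < 1 := by
    have h1 : w k < x k * lam k ↔ ∑ i ∈ S.erase k, w i < 1 := by
      have : x k * lam k = w k + lam k ^ 2 * (1 - ∑ i ∈ S.erase k, w i) := by
        rw [hxk]
        have := (hpos k).ne'
        field_simp
        ring
      rw [this, lt_add_iff_pos_right, mul_pos_iff_of_pos_left (pow_pos (hpos k) 2), sub_pos]
    have h2 : ∀ i ∈ S.erase k, (w k < x i * lam i ↔ 0 < w i) := fun i hi => by
      have : x i * lam i = w k + lam i ^ 2 * w i := by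
        rw [hxi i hi]
        have := (hpos i).ne'
        field_simp
        ring
      rw [this, lt_add_iff_pos_right, mul_pos_iff_of_pos_left (pow_pos (hpos i) 2)]
    constructor
    · exact fun h => ⟨fun i hi => (h2 i hi).1 (h i (Finset.mem_of_mem_erase hi)), h1.1 (h k hk)⟩
    · rintro ⟨h, h'⟩ i hi
      by_cases hik : i = k
      · exact hik ▸ h1.2 h'
      · exact (h2 i (Finset.mem_erase.2 ⟨hik, hi⟩)).2 (h i (Finset.mem_erase.2 ⟨hik, hi⟩))
  have hjmem : (∀ j ∉ S, 0 ≤ x j ∧ x j * lam j ≤ w k) ↔ ∀ j ∉ S, 0 ≤ w j ∧ w j ≤ w k := by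
    refine forall₂_congr fun j hj => ?_
    rw [hxj j hj, div_mul_cancel₀ _ (hpos j).ne', le_div_iff₀ (hpos j), zero_mul]
  show x ∈ faceRegion lam S ρ ↔ _
  simp only [faceRegion, Set.mem_ofPred_eq, ht, hsq, hSmem, hjmem]
  tauto

/-- The Gaussian integral attached to the face of the crosspolytope with support `S`. -/
noncomputable def faceIntegral (lam : ι → ℝ) (S : Finset ι) : ℝ :=
  ∫ x in Set.Ioi (0 : ℝ), Real.exp (-(∑ k ∈ S, 1 / lam k ^ 2) * x ^ 2) *
    ∏ j ∈ Finset.univ \ S, ∫ y in (0 : ℝ)..x, Real.exp (-(y ^ 2 / lam j ^ 2))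

theorem volume_real_preimage_faceRegion (hk : k ∈ S) (hpos : ∀ i, 0 < lam i) {ρ : ℝ} (hρ : 0 ≤ ρ) :
    volume.real ((fun w => Pi.single k (lam k) + faceMap lam S k w) ⁻¹' faceRegion lam S ρ) =
      1 / (S.card - 1).factorial * (ρ ^ (Fintype.card ι - (S.card - 1)) * (faceIntegral lam S /
        Real.Gamma (((Fintype.card ι - (S.card - 1) : ℕ) : ℝ) / 2 + 1))) := by
  rw [preimage_faceRegion hk hpos]
  have hAS : 0 < ∑ i ∈ S, 1 / lam i ^ 2 :=
    Finset.sum_pos (fun i _ => by have := hpos i; positivity) ⟨k, hk⟩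
  let κ := {i // ¬ i ∈ S.erase k}
  -- Coordinate `k` carries the level `t`, so it belongs to the cone factor, with weight `A` in
  -- place of `1 / lam k ^ 2`.
  let k' : κ := ⟨k, by simp⟩
  let b : κ → ℝ := fun j => if j = k' then ∑ i ∈ S, 1 / lam i ^ 2 else 1 / lam j ^ 2
  have hb : ∀ j, 0 < b j := fun j => by
    dsimp only [b]
    split_ifs
    · exact hAS
    · have := hpos j
      positivity
  let e := MeasurableEquiv.piEquivPiSubtypeProd (fun _ : ι => ℝ) (· ∈ S.erase k)
  have he : MeasurePreserving e := by
    convert volume_preserving_piEquivPiSubtypeProd (fun _ : ι => ℝ) (· ∈ S.erase k)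
  have hcardα : Fintype.card {i // i ∈ S.erase k} = S.card - 1 := by
    rw [Fintype.card_coe, Finset.card_erase_of_mem hk]
  have hcardκ : Fintype.card κ = Fintype.card ι - (S.card - 1) := by
    rw [Fintype.card_subtype_compl, hcardα]
  have hmap : Finset.univ \ S =
      ((Finset.univ : Finset κ).erase k').map (Function.Embedding.subtype _) := by
    ext j
    simp only [Finset.mem_sdiff, Finset.mem_univ, true_and, Finset.mem_map, Finset.mem_erase,
      and_true, Function.Embedding.subtype_apply]
    constructor
    · intro hj
      refine ⟨⟨j, fun h => hj (Finset.mem_of_mem_erase h)⟩, fun h => hj ?_, rfl⟩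
      have h : j = k := congrArg Subtype.val h
      exact h ▸ hk
    · rintro ⟨a, ha, rfl⟩ h
      exact a.2 (Finset.mem_erase.2 ⟨fun h' => ha (Subtype.ext h'), h⟩)
  have hbk : b k' = ∑ i ∈ S, 1 / lam i ^ 2 := if_pos rfl
  have hbj : ∀ j ∈ (Finset.univ : Finset κ).erase k', b j = 1 / lam j ^ 2 := fun j hj =>
    if_neg (Finset.ne_of_mem_erase hj)
  have hset : {w : ι → ℝ | ((∀ i ∈ S.erase k, 0 < w i) ∧ ∑ i ∈ S.erase k, w i < 1) ∧
        (0 < w k ∧ ∀ j ∉ S, 0 ≤ w j ∧ w j ≤ w k) ∧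
        (∑ i ∈ S, 1 / lam i ^ 2) * w k ^ 2 + ∑ j ∈ Finset.univ \ S, 1 / lam j ^ 2 * w j ^ 2 ≤
          ρ ^ 2} =
      e ⁻¹' ({z | (∀ i, 0 < z i) ∧ ∑ i, z i < 1} ×ˢ
        {v | (0 < v k' ∧ ∀ j, 0 ≤ v j ∧ v j ≤ v k') ∧ ∑ j, b j * v j ^ 2 ≤ ρ ^ 2}) := by
    ext w
    have he1 : ∀ i, (e w).1 i = w i := fun _ => rfl
    have he2 : ∀ j, (e w).2 j = w j := fun _ => rfl
    have hs1 : ∑ i : {i // i ∈ S.erase k}, w i = ∑ i ∈ S.erase k, w i :=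
      Finset.sum_coe_sort (S.erase k) w
    have hs2 : ∑ j, b j * w j ^ 2 = (∑ i ∈ S, 1 / lam i ^ 2) * w k ^ 2 +
        ∑ j ∈ Finset.univ \ S, 1 / lam j ^ 2 * w j ^ 2 := by
      rw [← Finset.add_sum_erase _ _ (Finset.mem_univ k'), hbk, hmap, Finset.sum_map]
      congr 1
      exact Finset.sum_congr rfl fun j hj => by rw [hbj j hj]; rfl
    have hs3 : 0 < w k → ((∀ j : κ, 0 ≤ w j ∧ w j ≤ w k) ↔ ∀ j ∉ S, 0 ≤ w j ∧ w j ≤ w k) := by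
      intro hwk
      constructor
      · exact fun h j hj => h ⟨j, fun h' => hj (Finset.mem_of_mem_erase h')⟩
      · intro h j
        by_cases hj : (j : ι) = k
        · rw [hj]
          exact ⟨hwk.le, le_rfl⟩
        · exact h j fun hjS => j.2 (Finset.mem_erase.2 ⟨hj, hjS⟩)
    have hs4 : (∀ i : {i // i ∈ S.erase k}, 0 < w i) ↔ ∀ i ∈ S.erase k, 0 < w i := Subtype.forall
    simp only [Set.mem_preimage, Set.mem_prod, Set.mem_ofPred_eq, he1, he2, hs1, hs2, hs4]
    exact and_congr Iff.rfl (and_congr_left fun _ => and_congr_right fun h => (hs3 h).symm)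
  rw [hset, he.measureReal_preimage]
  · rw [Measure.volume_eq_prod, measureReal_prod_prod, volume_real_cone k' hb hρ, hcardκ]
    have hsimplex : volume.real {z : {i // i ∈ S.erase k} → ℝ | (∀ i, 0 < z i) ∧ ∑ i, z i < 1} =
        1 / (S.card - 1).factorial := by
      rw [Measure.real, volume_open_simplex, ENNReal.toReal_ofReal (by positivity), hcardα]
    have hint : ∫ t in Set.Ioi (0 : ℝ), Real.exp (-b k' * t ^ 2) *
        ∏ j ∈ Finset.univ.erase k', ∫ u in (0 : ℝ)..t, Real.exp (-b j * u ^ 2) =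
        faceIntegral lam S := by
      unfold faceIntegral
      congr 1
      ext t
      rw [hbk, hmap, Finset.prod_map]
      congr 1
      refine Finset.prod_congr rfl fun j hj => ?_
      rw [hbj j hj]
      congr 1
      ext u
      congr 1
      simp only [Function.Embedding.subtype_apply]
      ring
    rw [← hsimplex, ← hint]
  · refine MeasurableSet.nullMeasurableSet (MeasurableSet.prod ?_ ?_)
    · exact measurableSet_open_simplex _
    · exact measurableSet_cone k' b ρ

theorem volume_real_faceRegion (hk : k ∈ S) (hpos : ∀ i, 0 < lam i) {ρ : ℝ} (hρ : 0 ≤ ρ) :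
    volume.real (faceRegion lam S ρ) =
      (∏ i, if i ∈ S then lam i else 1 / lam i) * (∑ i ∈ S, 1 / lam i ^ 2) *
      (1 / (S.card - 1).factorial * (ρ ^ (Fintype.card ι - (S.card - 1)) * (faceIntegral lam S /
        Real.Gamma (((Fintype.card ι - (S.card - 1) : ℕ) : ℝ) / 2 + 1)))) := by
  have hAS : 0 < ∑ i ∈ S, 1 / lam i ^ 2 :=
    Finset.sum_pos (fun i _ => by have := hpos i; positivity) ⟨k, hk⟩
  have hdet : 0 < LinearMap.det (faceMap lam S k) := by
    rw [det_faceMap]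
    refine mul_pos (Finset.prod_pos fun i _ => ?_) hAS
    have := hpos i
    split_ifs <;> positivity
  rw [← volume_real_preimage_faceRegion hk hpos hρ, ← det_faceMap lam S k, Measure.real,
    Measure.real, show (fun w => Pi.single k (lam k) + faceMap lam S k w) ⁻¹' faceRegion lam S ρ =
      faceMap lam S k ⁻¹' ((fun w => Pi.single k (lam k) + w) ⁻¹' faceRegion lam S ρ) from rfl,
    Measure.addHaar_preimage_linearMap _ hdet.ne', measure_preimage_add, ENNReal.toReal_mul,
    abs_of_pos (inv_pos.2 hdet), ENNReal.toReal_ofReal (inv_pos.2 hdet).le,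
    mul_inv_cancel_left₀ hdet.ne']

end Region

/-! ### Nearest points and the decomposition of the orthant. -/

section Decomposition

variable {ι : Type*} [Fintype ι] {lam : ι → ℝ} {S : Finset ι} {ρ : ℝ}

/-- The points at distance at most `ρ` from the crosspolytope, in coordinates. -/
def crossNeighborhood (lam : ι → ℝ) (ρ : ℝ) : Set (ι → ℝ) :=
  {x | ∃ c : ι → ℝ, ∑ i, |c i| / lam i ≤ 1 ∧ ∑ i, (x i - c i) ^ 2 ≤ ρ ^ 2}

theorem abs_mem_crossNeighborhood (x : ι → ℝ) :
    (fun i => |x i|) ∈ crossNeighborhood lam ρ ↔ x ∈ crossNeighborhood lam ρ := by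
  constructor
  · rintro ⟨c, hc, hd⟩
    refine ⟨fun i => if 0 ≤ x i then c i else -c i, ?_, ?_⟩
    · refine le_trans (le_of_eq (Finset.sum_congr rfl fun i _ => ?_)) hc
      beta_reduce
      split_ifs <;> simp
    · refine le_trans (le_of_eq (Finset.sum_congr rfl fun i _ => ?_)) hd
      beta_reduce
      rcases le_or_gt 0 (x i) with h | h
      · rw [if_pos h, abs_of_nonneg h]
      · rw [if_neg h.not_ge, abs_of_neg h]
        ring
  · rintro ⟨c, hc, hd⟩
    refine ⟨fun i => |c i|, by simpa using hc, (Finset.sum_le_sum fun i _ => ?_).trans hd⟩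
    exact sq_le_sq.2 (abs_abs_sub_abs_le _ _)

theorem crossNeighborhood_subset_Icc (hpos : ∀ i, 0 < lam i) (hρ : 0 ≤ ρ) :
    crossNeighborhood lam ρ ⊆ Set.Icc (fun i => -(lam i + ρ)) (fun i => lam i + ρ) := by
  rintro x ⟨c, hc, hd⟩
  have key : ∀ i, |x i| ≤ lam i + ρ := fun i => by
    have h1 : |c i| / lam i ≤ 1 := (Finset.single_le_sum (f := fun i => |c i| / lam i)
      (fun j _ => div_nonneg (abs_nonneg _) (hpos j).le) (Finset.mem_univ i)).trans hc
    rw [div_le_one (hpos i)] at h1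
    have h2 : (x i - c i) ^ 2 ≤ ρ ^ 2 := (Finset.single_le_sum (f := fun i => (x i - c i) ^ 2)
      (fun j _ => sq_nonneg _) (Finset.mem_univ i)).trans hd
    have h3 := abs_le_of_sq_le_sq h2 hρ
    have h4 : |x i| ≤ |c i| + |x i - c i| := by
      have := abs_add_le (c i) (x i - c i)
      rwa [add_sub_cancel] at this
    linarith
  exact ⟨fun i => (abs_le.1 (key i)).1, fun i => (abs_le.1 (key i)).2⟩

/-- The nearest point of the crosspolytope, given by soft thresholding at level `t`. -/
theorem mem_crossNeighborhood_iff [DecidableEq ι] (hpos : ∀ i, 0 < lam i) {x : ι → ℝ} {t : ℝ} (ht : 0 < t)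
    (hsum : ∑ i ∈ S, x i / lam i - 1 = t * ∑ i ∈ S, 1 / lam i ^ 2)
    (hS : ∀ i ∈ S, t < x i * lam i) (hS' : ∀ j ∉ S, 0 ≤ x j ∧ x j * lam j ≤ t) :
    x ∈ crossNeighborhood lam ρ ↔
      (∑ i ∈ S, 1 / lam i ^ 2) * t ^ 2 + ∑ j ∈ Finset.univ \ S, x j ^ 2 ≤ ρ ^ 2 := by
  -- `p` is the candidate nearest point and `r = x - p` the residual. Optimality is the variational
  -- inequality `⟪r, c⟫ ≤ t = ⟪r, p⟫` for every `c` in the crosspolytope.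
  let p : ι → ℝ := fun i => if i ∈ S then x i - t / lam i else 0
  let r : ι → ℝ := fun i => if i ∈ S then t / lam i else x i
  have hx : ∀ i, x i = r i + p i := fun i => by
    dsimp only [p, r]
    split_ifs <;> ring
  have hp0 : ∀ i, 0 ≤ p i := fun i => by
    dsimp only [p]
    split_ifs with h
    · rw [sub_nonneg, div_le_iff₀ (hpos i)]
      exact (hS i h).le
    · exact le_rfl
  have hr0 : ∀ i, 0 ≤ r i := fun i => by
    dsimp only [r]
    split_ifs with h
    · exact (div_pos ht (hpos i)).le
    · exact (hS' i h).1
  have hrt : ∀ i, r i ≤ t / lam i := fun i => by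
    dsimp only [r]
    split_ifs with h
    · exact le_rfl
    · rw [le_div_iff₀ (hpos i)]
      exact (hS' i h).2
  have hr2 : ∑ i, r i ^ 2 = (∑ i ∈ S, 1 / lam i ^ 2) * t ^ 2 + ∑ j ∈ Finset.univ \ S, x j ^ 2 := by
    rw [← Finset.sum_sdiff (Finset.subset_univ S), add_comm, Finset.sum_mul]
    congr 1
    · refine Finset.sum_congr rfl fun i hi => ?_
      simp only [r, if_pos hi]
      ring
    · refine Finset.sum_congr rfl fun i hi => ?_
      simp only [r, if_neg (Finset.mem_sdiff.1 hi).2]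
  have hpsum : ∑ i, p i / lam i = 1 := by
    have h1 : ∑ i, p i / lam i = ∑ i ∈ S, p i / lam i :=
      (Finset.sum_subset (Finset.subset_univ S) fun i _ hi => by simp [p, hi]).symm
    have h2 : ∑ i ∈ S, p i / lam i = ∑ i ∈ S, (x i / lam i - t * (1 / lam i ^ 2)) :=
      Finset.sum_congr rfl fun i hi => by
        simp only [p, if_pos hi]
        ring
    rw [h1, h2, Finset.sum_sub_distrib, ← Finset.mul_sum]
    linarith
  have hrp : ∑ i, r i * p i = t := by
    have : ∀ i, r i * p i = t * (p i / lam i) := fun i => by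
      dsimp only [r, p]
      split_ifs <;> ring
    simp_rw [this]
    rw [← Finset.mul_sum, hpsum, mul_one]
  rw [← hr2]
  constructor
  · rintro ⟨c, hc, hd⟩
    refine le_trans ?_ hd
    have h1 : ∑ i, r i * c i ≤ t := by
      calc ∑ i, r i * c i ≤ ∑ i, t * (|c i| / lam i) := Finset.sum_le_sum fun i _ => by
            calc r i * c i ≤ r i * |c i| := mul_le_mul_of_nonneg_left (le_abs_self _) (hr0 i)
              _ ≤ t / lam i * |c i| := mul_le_mul_of_nonneg_right (hrt i) (abs_nonneg _)
              _ = t * (|c i| / lam i) := by ring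
        _ = t * ∑ i, |c i| / lam i := by rw [Finset.mul_sum]
        _ ≤ t := by nlinarith
    have h2 : ∑ i, (x i - c i) ^ 2 =
        ∑ i, r i ^ 2 + 2 * (∑ i, r i * p i - ∑ i, r i * c i) + ∑ i, (p i - c i) ^ 2 := by
      rw [← Finset.sum_sub_distrib, Finset.mul_sum, ← Finset.sum_add_distrib,
        ← Finset.sum_add_distrib]
      refine Finset.sum_congr rfl fun i _ => ?_
      rw [hx i]
      ring
    have h3 : 0 ≤ ∑ i, (p i - c i) ^ 2 := Finset.sum_nonneg fun i _ => sq_nonneg _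
    linarith
  · intro h
    refine ⟨p, ?_, ?_⟩
    · simp_rw [abs_of_nonneg (hp0 _)]
      exact hpsum.le
    · convert h using 3 with i
      rw [hx i]
      ring

/-- This rewrites the equation for `t` without reference to `S`, so that levels coming from
different supports can be compared. -/
theorem sum_soft_threshold (hpos : ∀ i, 0 < lam i) {x : ι → ℝ} {t : ℝ}
    (hsum : ∑ i ∈ S, x i / lam i - 1 = t * ∑ i ∈ S, 1 / lam i ^ 2)
    (hS : ∀ i ∈ S, t < x i * lam i) (hS' : ∀ j ∉ S, x j * lam j ≤ t) :
    ∑ i, max ((x i * lam i - t) / lam i ^ 2) 0 = 1 := by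
  have h1 : ∑ i ∈ S, max ((x i * lam i - t) / lam i ^ 2) 0 =
      ∑ i, max ((x i * lam i - t) / lam i ^ 2) 0 :=
    Finset.sum_subset (Finset.subset_univ S) fun i _ hi => max_eq_right
      (div_nonpos_of_nonpos_of_nonneg (sub_nonpos.2 (hS' i hi)) (sq_nonneg _))
  have h2 : ∑ i ∈ S, max ((x i * lam i - t) / lam i ^ 2) 0 =
      ∑ i ∈ S, (x i / lam i - t * (1 / lam i ^ 2)) := Finset.sum_congr rfl fun i hi => by
    rw [max_eq_left (div_nonneg (sub_nonneg.2 (hS i hi).le) (sq_nonneg _))]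
    have := (hpos i).ne'
    field_simp
  rw [← h1, h2, Finset.sum_sub_distrib, ← Finset.mul_sum]
  linarith

/-- The sum decreases strictly in the level as long as it is positive: some term is then positive,
and lowering the level raises it. -/
theorem soft_threshold_unique (hpos : ∀ i, 0 < lam i) {x : ι → ℝ} {t t' : ℝ}
    (h : ∑ i, max ((x i * lam i - t) / lam i ^ 2) 0 = 1)
    (h' : ∑ i, max ((x i * lam i - t') / lam i ^ 2) 0 = 1) : t = t' := by
  have key : ∀ s s' : ℝ, ∑ i, max ((x i * lam i - s) / lam i ^ 2) 0 = 1 →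
      ∑ i, max ((x i * lam i - s') / lam i ^ 2) 0 = 1 → s ≤ s' := by
    intro s s' h h'
    by_contra! hlt
    have hne : ∑ i, max ((x i * lam i - s) / lam i ^ 2) 0 ≠ 0 := by rw [h]; norm_num
    obtain ⟨i, -, hi⟩ := Finset.exists_ne_zero_of_sum_ne_zero hne
    have hi : 0 < (x i * lam i - s) / lam i ^ 2 := by
      by_contra! hc
      exact hi (max_eq_right hc)
    have hmono : ∀ j, (x j * lam j - s) / lam j ^ 2 < (x j * lam j - s') / lam j ^ 2 := fun j =>
      div_lt_div_of_pos_right (by linarith) (pow_pos (hpos j) 2)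
    have := Finset.sum_lt_sum (s := Finset.univ)
      (f := fun i => max ((x i * lam i - s) / lam i ^ 2) 0)
      (g := fun i => max ((x i * lam i - s') / lam i ^ 2) 0)
      (fun j _ => max_le_max (hmono j).le le_rfl)
      ⟨i, Finset.mem_univ i, by
        rw [max_eq_left hi.le]
        exact (hmono i).trans_le (le_max_left _ _)⟩
    rw [h, h'] at this
    exact lt_irrefl _ this
  exact le_antisymm (key t t' h h') (key t' t h' h)

theorem exists_soft_threshold (hpos : ∀ i, 0 < lam i) {x : ι → ℝ} (hx : ∀ i, 0 ≤ x i)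
    (h1 : 1 < ∑ i, x i / lam i) :
    ∃ t, 0 < t ∧ ∑ i, max ((x i * lam i - t) / lam i ^ 2) 0 = 1 := by
  set f : ℝ → ℝ := fun t => ∑ i, max ((x i * lam i - t) / lam i ^ 2) 0 with hf
  have hxl : ∀ i, 0 ≤ x i * lam i := fun i => mul_nonneg (hx i) (hpos i).le
  have hcont : Continuous f := by fun_prop
  have hf0 : f 0 = ∑ i, x i / lam i := Finset.sum_congr rfl fun i _ => by
    rw [sub_zero, max_eq_left (div_nonneg (hxl i) (sq_nonneg _))]
    have := (hpos i).ne'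
    field_simp
  have hT : 0 ≤ ∑ i, x i * lam i := Finset.sum_nonneg fun i _ => hxl i
  have hfT : f (∑ i, x i * lam i) = 0 := Finset.sum_eq_zero fun i _ => max_eq_right
    (div_nonpos_of_nonpos_of_nonneg (sub_nonpos.2 (Finset.single_le_sum
      (f := fun i => x i * lam i) (fun j _ => hxl j) (Finset.mem_univ i))) (sq_nonneg _))
  obtain ⟨t, ht, hft⟩ := intermediate_value_Icc' hT hcont.continuousOn
    (show (1 : ℝ) ∈ Set.Icc (f (∑ i, x i * lam i)) (f 0) by
      rw [hfT, hf0]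
      exact ⟨zero_le_one, h1.le⟩)
  refine ⟨t, lt_of_le_of_ne ht.1 ?_, hft⟩
  rintro rfl
  linarith

/-- A common point has a single level `t`, and `t` determines the support as `{i | t < x i * lam
i}`. -/
theorem faceRegion_disjoint [DecidableEq ι] (hpos : ∀ i, 0 < lam i) {S S' : Finset ι} (hS : S.Nonempty)
    (hS' : S'.Nonempty) (h : S ≠ S') :
    Disjoint (faceRegion lam S ρ) (faceRegion lam S' ρ) := by
  have hA : ∀ S : Finset ι, S.Nonempty → ∑ i ∈ S, 1 / lam i ^ 2 ≠ 0 := fun S hS =>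
    (Finset.sum_pos (fun i _ => by have := hpos i; positivity) hS).ne'
  rw [Set.disjoint_left]
  rintro x ⟨-, h2, h3, -⟩ ⟨-, h2', h3', -⟩
  refine h ?_
  have ht := soft_threshold_unique hpos
    (sum_soft_threshold hpos (div_mul_cancel₀ _ (hA S hS)).symm h2 fun j hj => (h3 j hj).2)
    (sum_soft_threshold hpos (div_mul_cancel₀ _ (hA S' hS')).symm h2' fun j hj => (h3' j hj).2)
  rw [← ht] at h2' h3'
  ext i
  constructor
  · intro hi
    by_contra hc
    exact (h2 i hi).not_ge (h3' i hc).2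
  · intro hi
    by_contra hc
    exact (h2' i hi).not_ge (h3 i hc).2

theorem faceRegion_nonneg [DecidableEq ι] (hpos : ∀ i, 0 < lam i) {x : ι → ℝ} (hx : x ∈ faceRegion lam S ρ)
    (i : ι) : 0 ≤ x i := by
  by_cases hi : i ∈ S
  · exact (pos_of_mul_pos_left (hx.1.trans (hx.2.1 i hi)) (hpos i).le).le
  · exact (hx.2.2.1 i hi).1

theorem one_lt_of_mem_faceRegion [DecidableEq ι] (hpos : ∀ i, 0 < lam i) (hS : S.Nonempty) {x : ι → ℝ}
    (hx : x ∈ faceRegion lam S ρ) : 1 < ∑ i, x i / lam i := by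
  have hA : 0 < ∑ i ∈ S, 1 / lam i ^ 2 :=
    Finset.sum_pos (fun i _ => by have := hpos i; positivity) hS
  have h1 := (div_pos_iff_of_pos_right hA).1 hx.1
  have h2 := Finset.sum_le_sum_of_subset_of_nonneg (Finset.subset_univ S)
    (f := fun i => x i / lam i)
    fun i _ _ => div_nonneg (faceRegion_nonneg hpos hx i) (hpos i).le
  linarith

theorem crossNeighborhood_inter_orthant [DecidableEq ι] (hpos : ∀ i, 0 < lam i) :
    crossNeighborhood lam ρ ∩ (Set.univ.pi fun _ => Set.Ici 0) =
      ({x | ∑ i, x i / lam i ≤ 1} ∩ Set.univ.pi fun _ => Set.Ici 0) ∪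
        ⋃ S ∈ (Finset.univ : Finset (Finset ι)).filter Finset.Nonempty, faceRegion lam S ρ := by
  have hA : ∀ S : Finset ι, S.Nonempty → ∑ i ∈ S, 1 / lam i ^ 2 ≠ 0 := fun S hS =>
    (Finset.sum_pos (fun i _ => by have := hpos i; positivity) hS).ne'
  ext x
  simp only [Set.mem_inter_iff, Set.mem_union, Set.mem_univ_pi, Set.mem_Ici, Set.mem_ofPred_eq,
    Set.mem_iUnion, Finset.mem_filter, Finset.mem_univ, true_and, exists_prop]
  constructor
  · rintro ⟨hN, hx⟩
    rcases le_or_gt (∑ i, x i / lam i) 1 with h1 | h1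
    · exact Or.inl ⟨h1, hx⟩
    · obtain ⟨t, ht, hsum⟩ := exists_soft_threshold hpos hx h1
      let S : Finset ι := Finset.univ.filter fun i => t < x i * lam i
      have hmem : ∀ i, i ∈ S ↔ t < x i * lam i := fun i => by simp [S]
      have hsub : ∑ i ∈ S, max ((x i * lam i - t) / lam i ^ 2) 0 = 1 := by
        rw [← hsum]
        refine Finset.sum_subset (Finset.subset_univ S) fun i _ hi => max_eq_right
          (div_nonpos_of_nonpos_of_nonneg (sub_nonpos.2 ?_) (sq_nonneg _))
        rw [hmem, not_lt] at hi
        exact hi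
      have hne : S.Nonempty := by
        rw [Finset.nonempty_iff_ne_empty]
        intro h
        rw [h, Finset.sum_empty] at hsub
        norm_num at hsub
      have hsum' : ∑ i ∈ S, x i / lam i - 1 = t * ∑ i ∈ S, 1 / lam i ^ 2 := by
        have hmax : ∑ i ∈ S, max ((x i * lam i - t) / lam i ^ 2) 0 =
            ∑ i ∈ S, (x i / lam i - t * (1 / lam i ^ 2)) := Finset.sum_congr rfl fun i hi => by
          rw [max_eq_left (div_nonneg (sub_nonneg.2 ((hmem i).1 hi).le) (sq_nonneg _))]
          have := (hpos i).ne'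
          field_simp
        rw [hmax, Finset.sum_sub_distrib, ← Finset.mul_sum] at hsub
        linarith
      have hS : ∀ i ∈ S, t < x i * lam i := fun i hi => (hmem i).1 hi
      have hS' : ∀ j ∉ S, 0 ≤ x j ∧ x j * lam j ≤ t := fun j hj =>
        ⟨hx j, not_lt.1 fun h => hj ((hmem j).2 h)⟩
      have hteq : (∑ i ∈ S, x i / lam i - 1) / (∑ i ∈ S, 1 / lam i ^ 2) = t := by
        rw [hsum', mul_div_cancel_right₀ _ (hA S hne)]
      refine Or.inr ⟨S, hne, ?_⟩
      simp only [faceRegion, Set.mem_ofPred_eq, hteq]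
      exact ⟨ht, hS, hS', (mem_crossNeighborhood_iff hpos ht hsum' hS hS').1 hN⟩
  · rintro (⟨h1, hx⟩ | ⟨S, hne, hR⟩)
    · refine ⟨⟨x, ?_, ?_⟩, hx⟩
      · simpa only [abs_of_nonneg (hx _)] using h1
      · simpa using sq_nonneg ρ
    · refine ⟨?_, faceRegion_nonneg hpos hR⟩
      obtain ⟨ht, hS, hS', hd⟩ := hR
      exact (mem_crossNeighborhood_iff hpos ht (div_mul_cancel₀ _ (hA S hne)).symm hS hS').2 hd

theorem volume_real_crosspolytope_orthant [Nonempty ι] (hpos : ∀ i, 0 < lam i) :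
    volume.real ({x : ι → ℝ | ∑ i, x i / lam i ≤ 1} ∩ Set.univ.pi fun _ => Set.Ici 0) =
      (∏ i, lam i) / (Fintype.card ι).factorial := by
  classical
  have hm : MeasurableSet {x : ι → ℝ | ∑ i, x i / lam i ≤ 1} :=
    measurableSet_le (by fun_prop) measurable_const
  have h := congrArg ENNReal.toReal (volume_preimage_abs hm)
  have hdet : LinearMap.det (Matrix.toLin' (Matrix.diagonal fun i => 1 / lam i)) =
      (∏ i, lam i)⁻¹ := by
    rw [LinearMap.det_toLin', Matrix.det_diagonal]
    simp
  have hP : 0 < ∏ i, lam i := Finset.prod_pos fun i _ => hpos i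
  have hset : (fun (x : ι → ℝ) i => |x i|) ⁻¹' {x : ι → ℝ | ∑ i, x i / lam i ≤ 1} =
      Matrix.toLin' (Matrix.diagonal fun i => 1 / lam i) ⁻¹'
        {x : ι → ℝ | (∑ i, |x i| ^ (1 : ℝ)) ^ (1 / (1 : ℝ)) ≤ 1} := by
    ext x
    simp [Matrix.mulVec_diagonal, abs_mul, abs_of_pos, hpos, div_eq_inv_mul]
  rw [hset, Measure.addHaar_preimage_linearMap _ (by rw [hdet]; positivity), hdet,
    volume_sum_rpow_le ι le_rfl, inv_inv, abs_of_pos hP, ENNReal.toReal_mul, ENNReal.toReal_mul,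
    ENNReal.toReal_mul, ENNReal.toReal_ofReal hP.le] at h
  have h2 : Real.Gamma (1 / 1 + 1) = 1 := by norm_num
  rw [h2, mul_one, div_one, Real.Gamma_nat_eq_factorial, ENNReal.toReal_ofReal (by positivity)] at h
  simp only [ENNReal.ofReal_one, one_pow, ENNReal.toReal_one, one_mul, ENNReal.toReal_pow,
    ENNReal.toReal_ofNat] at h
  rw [Measure.real]
  have h3 : (2 : ℝ) ^ Fintype.card ι ≠ 0 := by positivity
  refine mul_left_cancel₀ h3 (h.symm.trans ?_)
  ring

theorem volume_real_crossNeighborhood [DecidableEq ι] [Nonempty ι] (hpos : ∀ i, 0 < lam i) (hρ : 0 ≤ ρ) :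
    volume.real (crossNeighborhood lam ρ) = 2 ^ Fintype.card ι *
      ((∏ i, lam i) / (Fintype.card ι).factorial +
        ∑ S ∈ (Finset.univ : Finset (Finset ι)).filter Finset.Nonempty,
          volume.real (faceRegion lam S ρ)) := by
  set O : Set (ι → ℝ) := Set.univ.pi fun _ => Set.Ici 0 with hO
  have hOm : MeasurableSet O := MeasurableSet.univ_pi fun _ => measurableSet_Ici
  have hBm : MeasurableSet {x : ι → ℝ | ∑ i, x i / lam i ≤ 1} :=
    measurableSet_le (by fun_prop) measurable_const
  have hdec := crossNeighborhood_inter_orthant hpos (ρ := ρ)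
  have hUm : MeasurableSet (⋃ S ∈ (Finset.univ : Finset (Finset ι)).filter Finset.Nonempty,
      faceRegion lam S ρ) :=
    Finset.measurableSet_biUnion _ fun S _ => measurableSet_faceRegion lam S ρ
  have hNm : MeasurableSet (crossNeighborhood lam ρ ∩ O) := by
    rw [hdec]
    exact (hBm.inter hOm).union hUm
  have hNabs : crossNeighborhood lam ρ =
      (fun (x : ι → ℝ) i => |x i|) ⁻¹' (crossNeighborhood lam ρ ∩ O) := by
    ext x
    rw [Set.mem_preimage, Set.mem_inter_iff, abs_mem_crossNeighborhood]
    exact (and_iff_left fun i _ => abs_nonneg (x i)).symm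
  have hfin : volume (crossNeighborhood lam ρ ∩ O) ≠ ⊤ :=
    measure_ne_top_of_subset (Set.inter_subset_left.trans (crossNeighborhood_subset_Icc hpos hρ))
      isCompact_Icc.measure_ne_top
  have h := congrArg ENNReal.toReal (volume_preimage_abs hNm)
  rw [← hNabs, Set.inter_assoc, ← hO, Set.inter_self, ENNReal.toReal_mul] at h
  rw [Measure.real, h]
  have h1 : (volume (crossNeighborhood lam ρ ∩ O)).toReal =
      volume.real (crossNeighborhood lam ρ ∩ O) := rfl
  rw [h1]
  rw [hdec] at hfin ⊢
  rw [measureReal_union _ hUm (measure_ne_top_of_subset Set.subset_union_left hfin)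
    (measure_ne_top_of_subset Set.subset_union_right hfin),
    volume_real_crosspolytope_orthant hpos, measureReal_biUnion_finset
      (fun S hS S' hS' hne => faceRegion_disjoint hpos (Finset.mem_filter.1 hS).2
        (Finset.mem_filter.1 hS').2 hne)
      (fun S _ => measurableSet_faceRegion lam S ρ)
      (fun S hS => measure_ne_top_of_subset
        ((Set.subset_biUnion_of_mem (u := fun S => faceRegion lam S ρ) hS).trans
          Set.subset_union_right) hfin)]
  · simp
  · rw [Set.disjoint_left]
    rintro x ⟨hx, -⟩ hx'
    simp only [Set.mem_iUnion, Finset.mem_filter, Finset.mem_univ, true_and, exists_prop] at hx'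
    obtain ⟨S, hS, hxS⟩ := hx'
    exact (one_lt_of_mem_faceRegion hpos hS hxS).not_ge hx

end Decomposition

/-! ### From the convex hull to the coordinate neighbourhood. -/

theorem mem_orthogonalCrosspolytope {n : ℕ} (hn : 1 ≤ n) {lam : Fin n → ℝ}
    (hpos : ∀ i, 0 < lam i) (x : EuclideanSpace ℝ (Fin n)) :
    x ∈ orthogonalCrosspolytope lam ↔ ∑ i, |x i| / lam i ≤ 1 := by
  constructor
  · let D : Set (EuclideanSpace ℝ (Fin n)) := {x | ∑ i, |x i| / lam i ≤ 1}
    have hD : Convex ℝ D := by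
      intro x hx y hy a b ha hb hab
      calc ∑ i, |(a • x + b • y) i| / lam i
          ≤ ∑ i, (a * (|x i| / lam i) + b * (|y i| / lam i)) := Finset.sum_le_sum fun i _ => by
            rw [← mul_div_assoc, ← mul_div_assoc, ← add_div]
            refine div_le_div_of_nonneg_right ?_ (hpos i).le
            calc |a * x i + b * y i| ≤ |a * x i| + |b * y i| := abs_add_le _ _
              _ = a * |x i| + b * |y i| := by
                rw [abs_mul, abs_mul, abs_of_nonneg ha, abs_of_nonneg hb]
        _ = a * ∑ i, |x i| / lam i + b * ∑ i, |y i| / lam i := by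
          rw [Finset.sum_add_distrib, Finset.mul_sum, Finset.mul_sum]
        _ ≤ a * 1 + b * 1 := add_le_add (mul_le_mul_of_nonneg_left hx ha)
          (mul_le_mul_of_nonneg_left hy hb)
        _ = 1 := by rw [mul_one, mul_one, hab]
    have hsingle : ∀ i, ∑ j, |(EuclideanSpace.single i (lam i) : EuclideanSpace ℝ (Fin n)) j| /
        lam j = 1 := fun i => by
      rw [Finset.sum_eq_single i]
      · simp [abs_of_pos (hpos i), (hpos i).ne']
      · intro j _ hj
        simp [hj]
      · simp
    refine fun hx => convexHull_min (t := D) ?_ hD hx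
    refine Set.iUnion_subset fun i y hy => ?_
    rcases hy with rfl | rfl
    · exact (hsingle i).le
    · show ∑ j, |(-EuclideanSpace.single i (lam i) : EuclideanSpace ℝ (Fin n)) j| / lam j ≤ 1
      simp only [PiLp.neg_apply, abs_neg]
      exact (hsingle i).le
  · intro hx
    have hC : Convex ℝ (orthogonalCrosspolytope lam) := convex_convexHull ℝ _
    let v : Fin n → EuclideanSpace ℝ (Fin n) := fun i =>
      if 0 ≤ x i then EuclideanSpace.single i (lam i) else -EuclideanSpace.single i (lam i)
    have hpm : ∀ i, EuclideanSpace.single i (lam i) ∈ orthogonalCrosspolytope lam ∧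
        -EuclideanSpace.single i (lam i) ∈ orthogonalCrosspolytope lam := fun i =>
      ⟨subset_convexHull ℝ _ (Set.mem_iUnion.2 ⟨i, Or.inl rfl⟩),
        subset_convexHull ℝ _ (Set.mem_iUnion.2 ⟨i, Or.inr rfl⟩)⟩
    have hv : ∀ i, v i ∈ orthogonalCrosspolytope lam := fun i => by
      dsimp only [v]
      split_ifs
      exacts [(hpm i).1, (hpm i).2]
    -- The origin is the midpoint of an antipodal pair of vertices; for `n = 0` the hull would be
    -- empty.
    have h0 : (0 : EuclideanSpace ℝ (Fin n)) ∈ orthogonalCrosspolytope lam := by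
      have h := hC (hpm ⟨0, hn⟩).1 (hpm ⟨0, hn⟩).2 (by norm_num : (0 : ℝ) ≤ 1 / 2)
        (by norm_num : (0 : ℝ) ≤ 1 / 2) (by norm_num)
      simpa using h
    have hw : ∀ i, 0 ≤ |x i| / lam i := fun i => div_nonneg (abs_nonneg _) (hpos i).le
    have hxsum : x = ∑ i, (|x i| / lam i) • v i := by
      ext j
      rw [WithLp.ofLp_sum, Finset.sum_apply, Finset.sum_eq_single j]
      · have := (hpos j).ne'
        rcases le_or_gt 0 (x j) with h | h
        · simp [v, h, abs_of_nonneg h, this]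
        · simp [v, h.not_ge, abs_of_neg h, this]
      · intro i _ hij
        dsimp only [v]
        split_ifs <;> simp [hij.symm]
      · simp
    -- The weights may sum to less than `1`. If they sum to `0` then `x = 0`; otherwise `x` is their
    -- centre of mass shrunk towards `0`.
    rcases (Finset.sum_nonneg fun i _ => hw i).eq_or_lt with hs | hs
    · have hz := (Finset.sum_eq_zero_iff_of_nonneg fun i _ => hw i).1 hs.symm
      rw [hxsum, Finset.sum_eq_zero fun i hi => by rw [hz i hi, zero_smul]]
      exact h0
    · have hm := hC.centerMass_mem (fun i _ => hw i) hs fun i _ => hv i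
      have := hC.smul_mem_of_zero_mem h0 hm ⟨hs.le, hx⟩
      rwa [Finset.centerMass, smul_inv_smul₀ hs.ne', ← hxsum] at this

theorem volume_real_parallel {n : ℕ} (hn : 1 ≤ n) {lam : Fin n → ℝ} (hpos : ∀ i, 0 < lam i)
    {ρ : ℝ} (hρ : 0 ≤ ρ) :
    volume.real (orthogonalCrosspolytope lam +
      ρ • Metric.closedBall (0 : EuclideanSpace ℝ (Fin n)) 1) =
      volume.real (crossNeighborhood lam ρ) := by
  have hset : orthogonalCrosspolytope lam +
      ρ • Metric.closedBall (0 : EuclideanSpace ℝ (Fin n)) 1 =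
      (MeasurableEquiv.toLp 2 (Fin n → ℝ)).symm ⁻¹' crossNeighborhood lam ρ := by
    have hball : ∀ x : EuclideanSpace ℝ (Fin n),
        x ∈ Metric.closedBall (0 : EuclideanSpace ℝ (Fin n)) ρ ↔ ∑ i, x i ^ 2 ≤ ρ ^ 2 := fun x => by
      rw [mem_closedBall_zero_iff, ← EuclideanSpace.real_norm_sq_eq,
        pow_le_pow_iff_left₀ (norm_nonneg _) hρ two_ne_zero]
    ext y
    rw [smul_unitClosedBall_of_nonneg hρ, Set.mem_preimage]
    constructor
    · rintro ⟨c, hc, b, hb, rfl⟩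
      refine ⟨c, (mem_orthogonalCrosspolytope hn hpos c).1 hc, ?_⟩
      convert (hball b).1 hb using 3 with i
      simp
    · rintro ⟨c, hc, hd⟩
      refine ⟨WithLp.toLp 2 c, (mem_orthogonalCrosspolytope hn hpos _).2 hc,
        y - WithLp.toLp 2 c, (hball _).2 hd, by simp⟩
  rw [hset, Measure.real, Measure.real,
    (EuclideanSpace.volume_preserving_symm_measurableEquiv_toLp (Fin n)).measure_preimage_equiv]

/-! ### Collecting powers of `ρ` and simplifying the coefficients. -/

theorem sum_prod_erase_sq {ι : Type*} [DecidableEq ι] {lam : ι → ℝ} (hpos : ∀ i, 0 < lam i)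
    (S : Finset ι) :
    ∑ k ∈ S, ∏ j ∈ S.erase k, lam j ^ 2 = (∏ i ∈ S, lam i ^ 2) * ∑ i ∈ S, 1 / lam i ^ 2 := by
  rw [Finset.mul_sum]
  refine Finset.sum_congr rfl fun k hk => ?_
  rw [← Finset.mul_prod_erase S _ hk]
  have := (hpos k).ne'
  field_simp

theorem faceMap_det_eq {ι : Type*} [Fintype ι] [DecidableEq ι] {lam : ι → ℝ}
    (hpos : ∀ i, 0 < lam i) (S : Finset ι) :
    (∏ i, if i ∈ S then lam i else 1 / lam i) * ∑ i ∈ S, 1 / lam i ^ 2 =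
      (∑ k ∈ S, ∏ j ∈ S.erase k, lam j ^ 2) / ∏ j, lam j := by
  have hP : ∏ j, lam j ≠ 0 := Finset.prod_ne_zero_iff.2 fun i _ => (hpos i).ne'
  have h : (∏ i, if i ∈ S then lam i else 1 / lam i) * ∏ j, lam j = ∏ i ∈ S, lam i ^ 2 := by
    rw [← Finset.prod_mul_distrib, ← Finset.prod_subset (Finset.subset_univ S)]
    · exact Finset.prod_congr rfl fun i hi => by rw [if_pos hi, sq]
    · intro i _ hi
      rw [if_neg hi, one_div_mul_cancel (hpos i).ne']
  rw [sum_prod_erase_sq hpos, eq_div_iff hP, ← h]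
  ring

/-- Grouping the nonempty subsets of a finite type by their cardinality. -/
theorem sum_nonempty_eq_sum_powersetCard {n : ℕ} (f : Finset (Fin n) → ℝ) :
    ∑ S ∈ (Finset.univ : Finset (Finset (Fin n))).filter Finset.Nonempty, f S =
      ∑ k ∈ Finset.range n, ∑ S ∈ Finset.powersetCard (n - k) Finset.univ, f S := by
  have hmaps : ∀ S ∈ (Finset.univ : Finset (Finset (Fin n))).filter Finset.Nonempty,
      n - S.card ∈ Finset.range n := fun S hS => by
    have h1 := Finset.card_pos.2 (Finset.mem_filter.1 hS).2
    have h2 := card_finset_fin_le S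
    rw [Finset.mem_range]
    omega
  rw [← Finset.sum_fiberwise_of_maps_to hmaps]
  refine Finset.sum_congr rfl fun k hk => Finset.sum_congr ?_ fun _ _ => rfl
  have hk := Finset.mem_range.1 hk
  ext S
  have h2 := card_finset_fin_le S
  simp only [Finset.mem_filter, Finset.mem_univ, true_and, Finset.mem_powersetCard,
    Finset.subset_univ, ← Finset.card_pos]
  omega

/-- The explicit Steiner coefficients of the orthogonal crosspolytope. -/
noncomputable def crosspolytopeCoeff {n : ℕ} (lam : Fin n → ℝ) (k : ℕ) : ℝ :=
  if k = 0 then 2 ^ n / (n.factorial : ℝ) * ∏ i, lam i else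
    2 ^ n / (n.choose k : ℝ) * ∑ S ∈ Finset.powersetCard (n - k + 1) Finset.univ,
      (∑ k ∈ S, ∏ j ∈ S.erase k, lam j ^ 2) / (∏ j, lam j) *
        (1 / (n - k).factorial * (faceIntegral lam S / Real.Gamma ((k : ℝ) / 2 + 1)))

theorem isSteinerCoeff_crosspolytope {n : ℕ} (hn : 1 ≤ n) {lam : Fin n → ℝ}
    (hpos : ∀ i, 0 < lam i) :
    IsSteinerCoeff (orthogonalCrosspolytope lam) (Metric.closedBall 0 1)
      (crosspolytopeCoeff lam) := by
  intro ρ hρ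
  have : Nonempty (Fin n) := ⟨⟨0, hn⟩⟩
  rw [volume_real_parallel hn hpos hρ, volume_real_crossNeighborhood hpos hρ,
    sum_nonempty_eq_sum_powersetCard, Finset.sum_range_succ', Fintype.card_fin, mul_add, add_comm,
    Finset.mul_sum]
  congr 1
  -- After splitting off the constant term, index `k` stands for `ρ ^ (k + 1)`, which comes from the
  -- supports of size `n - k`.
  · refine Finset.sum_congr rfl fun k hk => ?_
    have hk := Finset.mem_range.1 hk
    have hc : (n.choose (k + 1) : ℝ) ≠ 0 := Nat.cast_ne_zero.2 (Nat.choose_pos hk).ne'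
    rw [crosspolytopeCoeff, if_neg k.succ_ne_zero, ← mul_assoc, mul_div_cancel₀ _ hc,
      show n - (k + 1) + 1 = n - k by omega, mul_assoc, Finset.sum_mul]
    congr 1
    refine Finset.sum_congr rfl fun S hS => ?_
    have hS := (Finset.mem_powersetCard.1 hS).2
    obtain ⟨i, hi⟩ : S.Nonempty := Finset.card_pos.1 (by omega)
    rw [volume_real_faceRegion hi hpos hρ, faceMap_det_eq hpos, hS, Fintype.card_fin,
      show n - (n - k - 1) = k + 1 by omega, show n - k - 1 = n - (k + 1) by omega]
    ring
  · rw [crosspolytopeCoeff, if_pos rfl]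
    simp
    ring

/-- Only the full support (the facets) contributes. Its integral is a half Gaussian, whose `√π / 2`
cancels against `Γ(3/2)`. -/
theorem crosspolytopeCoeff_one {n : ℕ} (hn : 1 ≤ n) {lam : Fin n → ℝ} (hpos : ∀ i, 0 < lam i) :
    crosspolytopeCoeff lam 1 = 2 ^ n / (n.factorial : ℝ) *
      Real.sqrt (∑ i, ∏ j ∈ Finset.univ.erase i, lam j ^ 2) := by
  have : Nonempty (Fin n) := ⟨⟨0, hn⟩⟩
  have hA : 0 < ∑ i, 1 / lam i ^ 2 :=
    Finset.sum_pos (fun i _ => by have := hpos i; positivity) Finset.univ_nonempty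
  have hP : 0 < ∏ i, lam i := Finset.prod_pos fun i _ => hpos i
  have hI : faceIntegral lam Finset.univ / Real.Gamma (((1 : ℕ) : ℝ) / 2 + 1) =
      1 / √(∑ i, 1 / lam i ^ 2) := by
    have hpi := Real.sqrt_pos.2 Real.pi_pos
    have hsA := Real.sqrt_pos.2 hA
    rw [faceIntegral]
    simp only [Finset.sdiff_self, Finset.prod_empty, mul_one]
    rw [integral_gaussian_Ioi, Nat.cast_one, Real.Gamma_add_one (by norm_num),
      Real.Gamma_one_half_eq, Real.sqrt_div Real.pi_pos.le]
    field_simp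
  have hcard : Finset.powersetCard (n - 1 + 1) (Finset.univ : Finset (Fin n)) = {Finset.univ} := by
    conv_lhs => rw [show n - 1 + 1 = (Finset.univ : Finset (Fin n)).card by simp; omega]
    exact Finset.powersetCard_self _
  have hfac : (n.factorial : ℝ) = n * (n - 1).factorial := by
    exact_mod_cast (Nat.mul_factorial_pred (by omega)).symm
  have hn0 : (n : ℝ) ≠ 0 := by exact_mod_cast (by omega : n ≠ 0)
  have hf0 : ((n - 1).factorial : ℝ) ≠ 0 := Nat.cast_ne_zero.2 (Nat.factorial_ne_zero _)
  have hsq : √(∑ i, 1 / lam i ^ 2) ≠ 0 := (Real.sqrt_pos.2 hA).ne'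
  rw [crosspolytopeCoeff, if_neg one_ne_zero, hcard, Finset.sum_singleton, hI, Nat.choose_one_right,
    sum_prod_erase_sq hpos, Finset.prod_pow, hfac, Real.sqrt_mul (sq_nonneg _), Real.sqrt_sq hP.le]
  field_simp
  rw [Real.sq_sqrt hA.le]

theorem unitBallVolume_eq {m : ℕ} (hm : 1 ≤ m) :
    unitBallVolume m = √Real.pi ^ m / Real.Gamma ((m : ℝ) / 2 + 1) := by
  have : Nonempty (Fin m) := ⟨⟨0, hm⟩⟩
  have hΓ : 0 < Real.Gamma ((m : ℝ) / 2 + 1) := Real.Gamma_pos_of_pos (by positivity)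
  rw [unitBallVolume, Measure.real, EuclideanSpace.volume_closedBall, Fintype.card_fin]
  simp [ENNReal.toReal_ofReal (div_pos (pow_pos (Real.sqrt_pos.2 Real.pi_pos) m) hΓ).le]

/-- With `m = n - i`, the factor `1 / Γ(m/2 + 1)` is the unit ball volume divided by `π ^ (m / 2)`.
-/
theorem crosspolytopeCoeff_sub {n i : ℕ} (hi : i + 2 ≤ n) (lam : Fin n → ℝ) :
    crosspolytopeCoeff lam (n - i) =
      unitBallVolume (n - i) / (n.choose i : ℝ) *
        (2 ^ n / ((i.factorial : ℝ) * Real.pi ^ (((n : ℝ) - (i : ℝ)) / 2))) *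
        ∑ l ∈ Finset.powersetCard (i + 1) (Finset.univ : Finset (Fin n)),
          ((∑ k ∈ l, ∏ j ∈ l.erase k, lam j ^ 2) / (∏ j, lam j) * faceIntegral lam l) := by
  have hpow : Real.pi ^ (((n : ℝ) - (i : ℝ)) / 2) = √Real.pi ^ (n - i) := by
    rw [Real.sqrt_eq_rpow, ← Real.rpow_natCast, ← Real.rpow_mul Real.pi_pos.le,
      Nat.cast_sub (by omega)]
    congr 1
    ring
  have hpi : √Real.pi ^ (n - i) ≠ 0 := (pow_pos (Real.sqrt_pos.2 Real.pi_pos) _).ne'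
  have hΓ : Real.Gamma (((n - i : ℕ) : ℝ) / 2 + 1) ≠ 0 :=
    (Real.Gamma_pos_of_pos (by positivity)).ne'
  rw [crosspolytopeCoeff, if_neg (by omega), unitBallVolume_eq (by omega), hpow,
    Nat.choose_symm (by omega), show n - (n - i) = i by omega, Finset.mul_sum, Finset.mul_sum]
  refine Finset.sum_congr rfl fun S _ => ?_
  field_simp

theorem theorem3p6 (n : ℕ) (hn : 1 ≤ n) (lam : Fin n → ℝ)
    (hpos : ∀ i, 0 < lam i) (hmono : Monotone lam) :
    -- the Steiner formula holds, so the quermassintegrals below are its actual coefficients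
    (∀ ρ : ℝ, 0 ≤ ρ →
      volume.real (orthogonalCrosspolytope lam +
          ρ • Metric.closedBall (0 : EuclideanSpace ℝ (Fin n)) 1) =
        ∑ i ∈ Finset.range (n + 1),
          (n.choose i : ℝ) * quermassintegral (orthogonalCrosspolytope lam) i * ρ ^ i) ∧
    quermassintegral (orthogonalCrosspolytope lam) 0 =
      2 ^ n / (n.factorial : ℝ) * ∏ i, lam i ∧
    quermassintegral (orthogonalCrosspolytope lam) 1 =
      2 ^ n / (n.factorial : ℝ) *
        Real.sqrt (∑ i, ∏ j ∈ Finset.univ.erase i, lam j ^ 2) ∧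
    ∀ i : ℕ, i + 2 ≤ n →
      quermassintegral (orthogonalCrosspolytope lam) (n - i) =
        unitBallVolume (n - i) / (n.choose i : ℝ) *
          (2 ^ n / ((i.factorial : ℝ) * Real.pi ^ (((n : ℝ) - (i : ℝ)) / 2))) *
          ∑ l ∈ Finset.powersetCard (i + 1) (Finset.univ : Finset (Fin n)),
            ((∑ k ∈ l, ∏ j ∈ l.erase k, lam j ^ 2) / (∏ j, lam j) *
              ∫ x in Set.Ioi (0 : ℝ),
                Real.exp (-(∑ k ∈ l, 1 / lam k ^ 2) * x ^ 2) *
                  ∏ j ∈ Finset.univ \ l, ∫ y in (0 : ℝ)..x, Real.exp (-(y ^ 2 / lam j ^ 2))) := by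
  have hW := isSteinerCoeff_crosspolytope hn hpos
  have hq : ∀ i ≤ n, quermassintegral (orthogonalCrosspolytope lam) i = crosspolytopeCoeff lam i :=
    fun i hi => hW.relQuermassintegral_eq hi
  refine ⟨fun ρ hρ => ?_, ?_, ?_, fun i hi => ?_⟩
  · rw [hW ρ hρ]
    exact Finset.sum_congr rfl fun i hi => by rw [hq i (Nat.lt_succ_iff.1 (Finset.mem_range.1 hi))]
  · rw [hq 0 n.zero_le, crosspolytopeCoeff, if_pos rfl]
  · rw [hq 1 hn, crosspolytopeCoeff_one hn hpos]
  · rw [hq (n - i) (n.sub_le i)]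
    exact crosspolytopeCoeff_sub hi lam
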